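/- Let $p$ be a prime number, let $k,l$ be integers with $kl\neq 0$, and let $$\pi=\pi_1(S^3-J(2k,2l))=\langle a,b\mid w^l a=b w^l\rangle,\qquad w=(ba^{-1})^k(b^{-1}a)^k,$$ be the group of the double twist knot $J(2k,2l)$, given by its standard presentation. A function $\chi:\pi\to\mathbb Z_p$ is called a reducible (resp. irreducible) $\mathrm{SL}_2\mathbb Z_p$-character if there are an integral domain $R\supseteq\mathbb Z_p$ and a representation $\rho:\pi\to \mathrm{SL}_2(R)$ with $\operatorname{tr}\rho=\chi$ that is reducible (resp. irreducible) over an algebraic closure of the fraction field of $R$. A reducible $\mathrm{SL}_2\mathbb Z_p$-character $\chi$ is called liminal if every open neighbourhood of $\chi$, in the topology of pointwise $p$-adic convergence on functions $\pi\to\mathbb Z_p$, contains an irreducible $\mathrm{SL}_2\mathbb Z_p$-character. For a nonzero integer $n$, the square-free part of $n$ is $n/b^2$, where $b$ is the largest integer with $b^2\mid n$. Let $r$ be the square-free part of $4k^2l^2-kl$, which is nonzero. Then $\pi$ admits a liminal $\mathrm{SL}_2\mathbb Z_p$-character if and only if one of the following two conditions holds: (i) $p=2$ and $4k^2l^2-kl\equiv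 1 \pmod 8$; (ii) $p\neq 2$, $p\nmid kl$, and the Legendre symbol satisfies $\left(\dfrac{r}{p}\right)=1$. -/

import Mathlib

open scoped MatrixGroups

/-- The meridian `a` in the free group on two letters. -/
def DoubleTwist.a : FreeGroup (Fin 2) := FreeGroup.of 0

/-- The meridian `b` in the free group on two letters. -/
def DoubleTwist.b : FreeGroup (Fin 2) := FreeGroup.of 1

/-- The word `w = (b a⁻¹)ᵏ (b⁻¹ a)ᵏ`, for any integer `k`. -/
def DoubleTwist.w (k : ℤ) : FreeGroup (Fin 2) :=
  (DoubleTwist.b * DoubleTwist.a⁻¹) ^ k * (DoubleTwist.b⁻¹ * DoubleTwist.a) ^ k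

/-- The group `⟨a, b | wˡ a = b wˡ⟩` of the double twist knot `J(2k, 2l)`. -/
abbrev DoubleTwistKnotGroup (k l : ℤ) : Type :=
  PresentedGroup ({DoubleTwist.w k ^ l * DoubleTwist.a *
    (DoubleTwist.b * DoubleTwist.w k ^ l)⁻¹} : Set (FreeGroup (Fin 2)))

/-- For a domain `R`, the two-dimensional representation over an algebraic closure of the fraction
field of `R` that is obtained from `ρ : G → SL₂(R)` by extension of scalars. -/
noncomputable def geometricRep {G R : Type} [Group G] [CommRing R] [IsDomain R]
    (ρ : G →* SL(2, R)) :
    Representation (AlgebraicClosure (FractionRing R)) G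
      (Fin 2 → AlgebraicClosure (FractionRing R)) where
  toFun g := Matrix.toLin'
    ((ρ g : Matrix (Fin 2) (Fin 2) R).map (algebraMap R (AlgebraicClosure (FractionRing R))))
  map_one' := by
    simp [Module.End.one_eq_id]
  map_mul' g h := by
    simp [Matrix.map_mul, Matrix.toLin'_mul, Module.End.mul_eq_comp]

/-- Absolute irreducibility of an `SL₂`-representation over a domain. -/
def IsAbsIrreducibleRep {G R : Type} [Group G] [CommRing R] [IsDomain R]
    (ρ : G →* SL(2, R)) : Prop :=
  (geometricRep ρ).IsIrreducible

/-- The function `χ : G → ℤ_p` is the trace of the `SL₂`-representation `ρ` over the extension `R`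
of `ℤ_p`. -/
def IsTraceOf {p : ℕ} [Fact p.Prime] {G R : Type} [Group G] [CommRing R] [Algebra ℤ_[p] R]
    (χ : G → ℤ_[p]) (ρ : G →* SL(2, R)) : Prop :=
  ∀ g, algebraMap ℤ_[p] R (χ g) = (ρ g : Matrix (Fin 2) (Fin 2) R).trace

/-- `χ : G → ℤ_p` is the trace of an irreducible `SL₂`-representation over some domain that
extends `ℤ_p`. -/
def IsIrreducibleCharacter {p : ℕ} [Fact p.Prime] {G : Type} [Group G] (χ : G → ℤ_[p]) : Prop :=
  ∃ (R : Type) (_ : CommRing R) (_ : IsDomain R) (_ : Algebra ℤ_[p] R) (ρ : G →* SL(2, R)),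
    Function.Injective (algebraMap ℤ_[p] R) ∧ IsTraceOf χ ρ ∧ IsAbsIrreducibleRep ρ

/-- `χ : G → ℤ_p` is the trace of a reducible `SL₂`-representation over some domain that
extends `ℤ_p`. -/
def IsReducibleCharacter {p : ℕ} [Fact p.Prime] {G : Type} [Group G] (χ : G → ℤ_[p]) : Prop :=
  ∃ (R : Type) (_ : CommRing R) (_ : IsDomain R) (_ : Algebra ℤ_[p] R) (ρ : G →* SL(2, R)),
    Function.Injective (algebraMap ℤ_[p] R) ∧ IsTraceOf χ ρ ∧ ¬ IsAbsIrreducibleRep ρ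

/-- A liminal `SL₂ℤ_p`-character: a reducible character every open neighbourhood of which (for
pointwise `p`-adic convergence) contains an irreducible `SL₂ℤ_p`-character. -/
def IsLiminalCharacter {p : ℕ} [Fact p.Prime] {G : Type} [Group G] (χ : G → ℤ_[p]) : Prop :=
  IsReducibleCharacter χ ∧
    ∀ U : Set (G → ℤ_[p]), IsOpen U → χ ∈ U → ∃ χ' ∈ U, IsIrreducibleCharacter χ'

/-- The largest natural number `b` with `b² ∣ a`, for `a ≠ 0`. -/
def maxSquareDivisor (a : ℤ) : ℕ :=
  Nat.findGreatest (fun b => (b : ℤ) ^ 2 ∣ a) a.natAbs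

/-- The square-free part `a / b²` of `a ≠ 0`, where `b` is the largest integer with `b² ∣ a`. -/
def squareFreePart (a : ℤ) : ℤ :=
  a / (maxSquareDivisor a : ℤ) ^ 2

/-! Put `x = tr a = tr b` and `y = tr (b a⁻¹)`. For matrices `A`, `B` in `SL₂` with common trace,
the difference `wˡ A - B wˡ` is a scalar, the Riley polynomial at `(x, y)`, times `A - B`
(`slW_zpow_mul_sub_mul`). Irreducible characters therefore lie on the closed set where this
polynomial vanishes, while reducible ones have `y = 2`. A liminal character satisfies both, and at
`y = 2` the equation becomes `1 + kl(x² - 4) = 0`, the Alexander polynomial in terms of traces.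

Conversely, a root `x ∈ ℤ_p` of this equation is simple, so Hensel's lemma deforms it to zeros `(z,
y)` of the Riley polynomial with `y → 2`, `y ≠ 2` (`exists_riley_root_near`). Riley's matrices
realise these zeros by irreducible representations, and every trace is a continuous function of `(z,
y)` (`exists_word_trace`), so the characters converge.

It remains to solve the equation in `ℤ_p` (`exists_padicInt_root_iff`): with `m = kl` it reads
`(mx)² = 4m² - m`, so `m` must be a unit and `4m² - m` a square. -/

open Polynomial Filter Topology

/-! ### Trace identities in `SL₂` and the Riley polynomial. -/

section SpecialLinear

variable {R : Type*} [CommRing R]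

theorem SL2_coe_inv (A : SL(2, R)) :
    ((A⁻¹ : SL(2, R)) : Matrix (Fin 2) (Fin 2) R) =
      (A : Matrix (Fin 2) (Fin 2) R).trace • (1 : Matrix (Fin 2) (Fin 2) R) - A := by
  rw [Matrix.SpecialLinearGroup.coe_inv, Matrix.adjugate_fin_two]
  ext i j
  fin_cases i <;> fin_cases j <;> simp [Matrix.trace_fin_two]

theorem SL2_sq (A : SL(2, R)) :
    (A : Matrix (Fin 2) (Fin 2) R) * A =
      (A : Matrix (Fin 2) (Fin 2) R).trace • (A : Matrix (Fin 2) (Fin 2) R) - 1 := by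
  have h : ((A⁻¹ : SL(2, R)) : Matrix (Fin 2) (Fin 2) R) * A = 1 := by
    rw [← Matrix.SpecialLinearGroup.coe_mul]; simp
  rw [SL2_coe_inv, sub_mul, smul_mul_assoc, one_mul] at h
  rw [← h]; abel

/-- Powers in `SL₂` through Chebyshev polynomials of the trace. -/
theorem SL2_coe_zpow (A : SL(2, R)) (n : ℤ) :
    ((A ^ n : SL(2, R)) : Matrix (Fin 2) (Fin 2) R) =
      (Chebyshev.S R (n - 1)).eval (A : Matrix (Fin 2) (Fin 2) R).trace •
          (A : Matrix (Fin 2) (Fin 2) R) -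
        (Chebyshev.S R (n - 2)).eval (A : Matrix (Fin 2) (Fin 2) R).trace •
          (1 : Matrix (Fin 2) (Fin 2) R) := by
  set t := (A : Matrix (Fin 2) (Fin 2) R).trace with ht
  have hrec (m : ℤ) : (Chebyshev.S R m).eval t =
      t * (Chebyshev.S R (m - 1)).eval t - (Chebyshev.S R (m - 2)).eval t := by
    rw [Chebyshev.S_eq]; simp
  induction n with
  | zero => simp
  | succ n ih =>
    rw [zpow_add_one, Matrix.SpecialLinearGroup.coe_mul, ih, sub_mul, smul_mul_assoc, SL2_sq, ← ht,
      show (n : ℤ) + 1 - 1 = n by ring, show (n : ℤ) + 1 - 2 = n - 1 by ring, hrec n]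
    simp only [smul_mul_assoc, one_mul]
    module
  | pred n ih =>
    have h := hrec (-n - 1)
    rw [show (-n - 1 - 1 : ℤ) = -n - 2 by ring] at h
    rw [zpow_sub_one, Matrix.SpecialLinearGroup.coe_mul, ih, SL2_coe_inv, ← ht, sub_mul,
      smul_mul_assoc, mul_sub, SL2_sq, ← ht, h, show (-n - 1 - 1 : ℤ) = -n - 2 by ring]
    simp only [smul_mul_assoc, one_mul, mul_smul_comm, mul_one]
    module

/-- The trace of `w = (b a⁻¹)ᵏ (b⁻¹ a)ᵏ` in terms of `x = tr a = tr b` and `y = tr (b a⁻¹)`. -/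
noncomputable def wTrace (k : ℤ) (x y : R) : R :=
  2 + (y - 2) * (y + 2 - x ^ 2) * (Chebyshev.S R (k - 1)).eval y ^ 2

/-- The Riley polynomial of the double twist knot `J(2k, 2l)` in the variables `x = tr a = tr b`
and `y = tr (b a⁻¹)`. -/
noncomputable def rileyPoly (k l : ℤ) (x y : R) : R :=
  (Chebyshev.S R (l - 1)).eval (wTrace k x y) *
      (1 + (x ^ 2 - y - 2) * (Chebyshev.S R (k - 1)).eval y *
        ((Chebyshev.S R (k - 1)).eval y - (Chebyshev.S R (k - 2)).eval y)) -
    (Chebyshev.S R (l - 2)).eval (wTrace k x y)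

theorem map_eval_chebyshevS {R' : Type*} [CommRing R'] (f : R →+* R') (n : ℤ) (t : R) :
    f ((Chebyshev.S R n).eval t) = (Chebyshev.S R' n).eval (f t) := by
  rw [← Chebyshev.map_S f, eval_map_apply]

theorem map_wTrace {R' : Type*} [CommRing R'] (f : R →+* R') (k : ℤ) (x y : R) :
    f (wTrace k x y) = wTrace k (f x) (f y) := by
  simp [wTrace, map_eval_chebyshevS, map_ofNat]

/-- Allows passage between numerical values and the polynomial rings to which Hensel's lemma is
applied. -/
theorem map_rileyPoly {R' : Type*} [CommRing R'] (f : R →+* R') (k l : ℤ) (x y : R) :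
    f (rileyPoly k l x y) = rileyPoly k l (f x) (f y) := by
  simp [rileyPoly, map_eval_chebyshevS, map_ofNat, map_wTrace]

theorem rileyPoly_two (k l : ℤ) (x : R) : rileyPoly k l x 2 = 1 + k * l * (x ^ 2 - 4) := by
  have : wTrace k x 2 = 2 := by simp [wTrace]
  rw [rileyPoly, this]
  simp only [Chebyshev.S_eval_two]
  push_cast
  ring

/-- This is `det (Mᵏ) = 1` for `M` in `SL₂` of trace `y`, written through `Mᵏ = S_{k-1}(y) M -
S_{k-2}(y)`. -/
theorem chebyshevS_eval_sq (k : ℤ) (y : R) :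
    (Chebyshev.S R (k - 1)).eval y ^ 2 + (Chebyshev.S R (k - 2)).eval y ^ 2 -
      y * (Chebyshev.S R (k - 1)).eval y * (Chebyshev.S R (k - 2)).eval y = 1 := by
  have h := congrArg (Polynomial.eval y) (Chebyshev.S_sq_add_S_sq R (k - 2))
  rw [show k - 2 + 1 = k - 1 by ring] at h
  simp only [eval_sub, eval_add, eval_pow, eval_mul, eval_X, eval_one] at h
  linear_combination h

/-- The image in `SL₂` of the word `w`. -/
def slW (k : ℤ) (A B : SL(2, R)) : SL(2, R) := (B * A⁻¹) ^ k * (B⁻¹ * A) ^ k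

/-- Both traces equal `tr A · tr B - tr (BA)`. Hence the two factors of `w` expand with the same
Chebyshev coefficients. -/
theorem trace_inv_mul_eq {A B : SL(2, R)}
    (h : (A : Matrix (Fin 2) (Fin 2) R).trace = (B : Matrix (Fin 2) (Fin 2) R).trace) :
    ((B⁻¹ * A : SL(2, R)) : Matrix (Fin 2) (Fin 2) R).trace =
      ((B * A⁻¹ : SL(2, R)) : Matrix (Fin 2) (Fin 2) R).trace := by
  simp only [Matrix.SpecialLinearGroup.coe_mul, SL2_coe_inv, sub_mul, mul_sub, smul_mul_assoc,
    mul_smul_comm, one_mul, mul_one, Matrix.trace_sub, Matrix.trace_smul, h]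

theorem trace_comm_SL2 {A B : SL(2, R)} {x y : R}
    (hA : (A : Matrix (Fin 2) (Fin 2) R).trace = x) (hB : (B : Matrix (Fin 2) (Fin 2) R).trace = x)
    (hy : ((B * A⁻¹ : SL(2, R)) : Matrix (Fin 2) (Fin 2) R).trace = y) :
    ((B * A⁻¹ * (B⁻¹ * A) : SL(2, R)) : Matrix (Fin 2) (Fin 2) R).trace =
      2 + (y - 2) * (y + 2 - x ^ 2) := by
  subst hy hA
  have dA := A.det_coe
  have dB := B.det_coe
  rw [Matrix.det_fin_two] at dA dB
  simp only [Matrix.SpecialLinearGroup.coe_mul, Matrix.SpecialLinearGroup.coe_inv,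
    Matrix.adjugate_fin_two, Matrix.trace_fin_two, Matrix.mul_apply, Fin.sum_univ_two,
    Matrix.of_apply, Matrix.cons_val_zero, Matrix.cons_val_one, Matrix.cons_val',
    Matrix.cons_val_fin_one] at hB ⊢
  grind

/-- The linear map `M ↦ MA - BM` sends each of the three terms in the expansion of `w` to a multiple
of `A - B`. This is why the matrix relation collapses to one scalar equation. -/
theorem comm_mul_sub_mul_comm {A B : SL(2, R)} {x y : R}
    (hA : (A : Matrix (Fin 2) (Fin 2) R).trace = x) (hB : (B : Matrix (Fin 2) (Fin 2) R).trace = x)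
    (hy : ((B * A⁻¹ : SL(2, R)) : Matrix (Fin 2) (Fin 2) R).trace = y) :
    ((B * A⁻¹ * (B⁻¹ * A) * A : SL(2, R)) : Matrix (Fin 2) (Fin 2) R) -
        ((B * (B * A⁻¹ * (B⁻¹ * A)) : SL(2, R)) : Matrix (Fin 2) (Fin 2) R) =
      (x ^ 2 - y - 1) • ((A : Matrix (Fin 2) (Fin 2) R) - B) := by
  subst hy hA
  have dA := A.det_coe
  have dB := B.det_coe
  rw [Matrix.det_fin_two] at dA dB
  ext i j
  fin_cases i <;> fin_cases j <;>
  simp only [Matrix.SpecialLinearGroup.coe_mul, Matrix.SpecialLinearGroup.coe_inv,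
    Matrix.adjugate_fin_two, Matrix.trace_fin_two, Matrix.mul_apply, Fin.sum_univ_two,
    Matrix.of_apply, Matrix.cons_val_zero, Matrix.cons_val_one, Matrix.cons_val',
    Matrix.cons_val_fin_one, Matrix.sub_apply, Matrix.smul_apply, smul_eq_mul,
    Fin.zero_eta, Fin.mk_one, Fin.isValue] at hB ⊢ <;>
  grind

theorem mul_add_mul_sub_mul {A B : SL(2, R)} {x : R}
    (hA : (A : Matrix (Fin 2) (Fin 2) R).trace = x)
    (hB : (B : Matrix (Fin 2) (Fin 2) R).trace = x) :
    (((B * A⁻¹ : SL(2, R)) : Matrix (Fin 2) (Fin 2) R) +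
          ((B⁻¹ * A : SL(2, R)) : Matrix (Fin 2) (Fin 2) R)) * A -
        B * (((B * A⁻¹ : SL(2, R)) : Matrix (Fin 2) (Fin 2) R) +
          ((B⁻¹ * A : SL(2, R)) : Matrix (Fin 2) (Fin 2) R)) =
      (x ^ 2 - 2) • ((A : Matrix (Fin 2) (Fin 2) R) - B) := by
  subst hA
  have dA := A.det_coe
  have dB := B.det_coe
  rw [Matrix.det_fin_two] at dA dB
  ext i j
  fin_cases i <;> fin_cases j <;>
  simp only [Matrix.SpecialLinearGroup.coe_mul, Matrix.SpecialLinearGroup.coe_inv,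
    Matrix.adjugate_fin_two, Matrix.trace_fin_two, Matrix.mul_apply, Fin.sum_univ_two,
    Matrix.of_apply, Matrix.cons_val_zero, Matrix.cons_val_one, Matrix.cons_val',
    Matrix.cons_val_fin_one, Matrix.sub_apply, Matrix.add_apply, Matrix.smul_apply, smul_eq_mul,
    Fin.zero_eta, Fin.mk_one, Fin.isValue] at hB ⊢ <;>
  grind

theorem coe_slW {A B : SL(2, R)} {x y : R} (k : ℤ)
    (hA : (A : Matrix (Fin 2) (Fin 2) R).trace = x) (hB : (B : Matrix (Fin 2) (Fin 2) R).trace = x)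
    (hy : ((B * A⁻¹ : SL(2, R)) : Matrix (Fin 2) (Fin 2) R).trace = y) :
    (slW k A B : Matrix (Fin 2) (Fin 2) R) =
      (Chebyshev.S R (k - 1)).eval y ^ 2 •
          ((B * A⁻¹ * (B⁻¹ * A) : SL(2, R)) : Matrix (Fin 2) (Fin 2) R) -
        ((Chebyshev.S R (k - 1)).eval y * (Chebyshev.S R (k - 2)).eval y) •
          (((B * A⁻¹ : SL(2, R)) : Matrix (Fin 2) (Fin 2) R) +
            ((B⁻¹ * A : SL(2, R)) : Matrix (Fin 2) (Fin 2) R)) +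
        (Chebyshev.S R (k - 2)).eval y ^ 2 • (1 : Matrix (Fin 2) (Fin 2) R) := by
  have hy' := (trace_inv_mul_eq (hA.trans hB.symm)).trans hy
  rw [slW, Matrix.SpecialLinearGroup.coe_mul, SL2_coe_zpow, SL2_coe_zpow, hy, hy',
    Matrix.SpecialLinearGroup.coe_mul (B * A⁻¹)]
  simp only [sub_mul, mul_sub, smul_mul_assoc, mul_smul_comm, one_mul, mul_one]
  module

theorem trace_slW {A B : SL(2, R)} {x y : R} (k : ℤ)
    (hA : (A : Matrix (Fin 2) (Fin 2) R).trace = x) (hB : (B : Matrix (Fin 2) (Fin 2) R).trace = x)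
    (hy : ((B * A⁻¹ : SL(2, R)) : Matrix (Fin 2) (Fin 2) R).trace = y) :
    (slW k A B : Matrix (Fin 2) (Fin 2) R).trace = wTrace k x y := by
  have hy' := (trace_inv_mul_eq (hA.trans hB.symm)).trans hy
  rw [coe_slW k hA hB hy, wTrace, Matrix.trace_add, Matrix.trace_sub, Matrix.trace_smul,
    Matrix.trace_smul, Matrix.trace_smul, Matrix.trace_add, trace_comm_SL2 hA hB hy, hy, hy',
    Matrix.trace_one, Fintype.card_fin]
  simp only [smul_eq_mul, Nat.cast_ofNat]
  linear_combination 2 * chebyshevS_eval_sq k y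

/-- The defining relation of the double twist knot group, evaluated on matrices. -/
theorem slW_zpow_mul_sub_mul {A B : SL(2, R)} {x y : R} (k l : ℤ)
    (hA : (A : Matrix (Fin 2) (Fin 2) R).trace = x) (hB : (B : Matrix (Fin 2) (Fin 2) R).trace = x)
    (hy : ((B * A⁻¹ : SL(2, R)) : Matrix (Fin 2) (Fin 2) R).trace = y) :
    ((slW k A B ^ l * A : SL(2, R)) : Matrix (Fin 2) (Fin 2) R) -
        ((B * slW k A B ^ l : SL(2, R)) : Matrix (Fin 2) (Fin 2) R) =
      rileyPoly k l x y • ((A : Matrix (Fin 2) (Fin 2) R) - B) := by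
  have h₁ := comm_mul_sub_mul_comm hA hB hy
  have h₂ := mul_add_mul_sub_mul hA hB
  have h₃ := chebyshevS_eval_sq k y
  rw [Matrix.SpecialLinearGroup.coe_mul _ A, Matrix.SpecialLinearGroup.coe_mul B (_ * _)] at h₁
  rw [Matrix.SpecialLinearGroup.coe_mul, Matrix.SpecialLinearGroup.coe_mul B, SL2_coe_zpow,
    trace_slW k hA hB hy, rileyPoly]
  set σ := (Chebyshev.S R (l - 1)).eval (wTrace k x y)
  set σ' := (Chebyshev.S R (l - 2)).eval (wTrace k x y)
  set s := (Chebyshev.S R (k - 1)).eval y with hs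
  set s' := (Chebyshev.S R (k - 2)).eval y with hs'
  -- The case `l = 1`. The general case follows by linearity, since `Wˡ` is a combination of `W` and
  -- `1`.
  have h₄ : (slW k A B : Matrix (Fin 2) (Fin 2) R) * (A : Matrix (Fin 2) (Fin 2) R) -
        (B : Matrix (Fin 2) (Fin 2) R) * (slW k A B : Matrix (Fin 2) (Fin 2) R) =
      (1 + (x ^ 2 - y - 2) * s * (s - s')) • ((A : Matrix (Fin 2) (Fin 2) R) - B) := by
    rw [coe_slW k hA hB hy, ← hs, ← hs']
    generalize (((B * A⁻¹ * (B⁻¹ * A) : SL(2, R)) : Matrix (Fin 2) (Fin 2) R)) = C at h₁ ⊢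
    generalize (((B * A⁻¹ : SL(2, R)) : Matrix (Fin 2) (Fin 2) R) +
            ((B⁻¹ * A : SL(2, R)) : Matrix (Fin 2) (Fin 2) R)) = D at h₂ ⊢
    have h₅ : (s ^ 2 • C - (s * s') • D + s' ^ 2 • (1 : Matrix (Fin 2) (Fin 2) R)) * A -
          B * (s ^ 2 • C - (s * s') • D + s' ^ 2 • (1 : Matrix (Fin 2) (Fin 2) R)) =
        s ^ 2 • (C * (A : Matrix (Fin 2) (Fin 2) R) - B * C) -
          (s * s') • (D * (A : Matrix (Fin 2) (Fin 2) R) - B * D) +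
          s' ^ 2 • ((A : Matrix (Fin 2) (Fin 2) R) - B) := by
      simp only [add_mul, mul_add, sub_mul, mul_sub, smul_mul_assoc, mul_smul_comm, one_mul,
        mul_one]
      module
    rw [h₅, h₁, h₂, smul_smul, smul_smul, ← sub_smul, ← add_smul]
    congr 1
    linear_combination h₃
  generalize (slW k A B : Matrix (Fin 2) (Fin 2) R) = W at h₄ ⊢
  have h₆ : (σ • W - σ' • (1 : Matrix (Fin 2) (Fin 2) R)) * A -
        B * (σ • W - σ' • (1 : Matrix (Fin 2) (Fin 2) R)) =
      σ • (W * (A : Matrix (Fin 2) (Fin 2) R) - B * W) -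
        σ' • ((A : Matrix (Fin 2) (Fin 2) R) - B) := by
    simp only [sub_mul, mul_sub, smul_mul_assoc, mul_smul_comm, one_mul, mul_one]
    module
  rw [h₆, h₄, smul_smul, ← sub_smul]

end SpecialLinear

/-! ### Hensel's lemma in families. -/

section Padic

variable {p : ℕ} [Fact p.Prime]

/-- Hensel's lemma with a quantitative bound for the root. -/
theorem exists_root_norm_sub_mul_eq {F : ℤ_[p][X]} {a : ℤ_[p]}
    (h : ‖F.eval a‖ < ‖F.derivative.eval a‖ ^ 2) :
    ∃ z, F.eval z = 0 ∧ ‖z - a‖ * ‖F.derivative.eval a‖ = ‖F.eval a‖ := by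
  have h' : ‖F.aeval a‖ < ‖F.derivative.aeval a‖ ^ 2 := by simpa [coe_aeval_eq_eval] using h
  obtain ⟨z, hz, hza, -, -⟩ := hensels_lemma h'
  simp only [coe_aeval_eq_eval] at hz hza
  refine ⟨z, hz, ?_⟩
  -- Taylor expansion at `a` gives `F(a) = -(z - a)(F'(a) + c(z - a))`. The term `c(z - a)` is
  -- smaller than `F'(a)`, so the second factor has norm `‖F'(a)‖`.
  obtain ⟨c, hc⟩ := F.binomExpansion a (z - a)
  rw [add_sub_cancel, hz] at hc
  have h₁ : F.eval a = -((z - a) * (F.derivative.eval a + c * (z - a))) := by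
    linear_combination -hc
  have h₂ : ‖c * (z - a)‖ < ‖F.derivative.eval a‖ := by
    rw [norm_mul]
    exact (mul_le_of_le_one_left (norm_nonneg _) (PadicInt.norm_le_one c)).trans_lt hza
  rw [h₁, norm_neg, norm_mul, PadicInt.norm_add_eq_max_of_ne h₂.ne', max_eq_left h₂.le]

/-- A continuous family of polynomials (in the variable `X`, with parameter `y`) has roots near a
simple root. -/
theorem exists_root_near (Φ : ℤ_[p][X][X]) {x y₀ : ℤ_[p]} (h₀ : (Φ.map (evalRingHom y₀)).eval x = 0)
    (h₁ : (Φ.map (evalRingHom y₀)).derivative.eval x ≠ 0) {ε : ℝ} (hε : 0 < ε) :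
    ∀ᶠ y in 𝓝 y₀, ∃ z, (Φ.map (evalRingHom y)).eval z = 0 ∧ ‖z - x‖ < ε := by
  have hcont (Ψ : ℤ_[p][X][X]) : Continuous fun y : ℤ_[p] => ‖(Ψ.map (evalRingHom y)).eval x‖ := by
    have h (y : ℤ_[p]) : (Ψ.map (evalRingHom y)).eval x = (Ψ.eval (C x)).eval y := by
      exact map_evalRingHom_eval _ _ _
    simp only [h]
    exact ((Ψ.eval (C x)).continuous).norm
  have hd (y : ℤ_[p]) : (Φ.map (evalRingHom y)).derivative = Φ.derivative.map (evalRingHom y) :=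
    derivative_map _ _
  simp only [hd] at h₁ ⊢
  have e₁ := (hcont Φ).tendsto y₀
  have e₂ := (hcont Φ.derivative).tendsto y₀
  set d := ‖(Φ.derivative.map (evalRingHom y₀)).eval x‖ with hdd
  have hd0 : 0 < d := norm_pos_iff.mpr h₁
  rw [h₀, norm_zero] at e₁
  have e₃ : ∀ᶠ y in 𝓝 y₀, d / 2 < ‖(Φ.derivative.map (evalRingHom y)).eval x‖ :=
    e₂.eventually_const_lt (by linarith)
  -- The bound `(d/2)²` secures Hensel's hypothesis; the bound `ε · (d/2)` places the root within
  -- `ε` of `x`.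
  have e₄ : ∀ᶠ y in 𝓝 y₀, ‖(Φ.map (evalRingHom y)).eval x‖ < min ((d / 2) ^ 2) (ε * (d / 2)) :=
    e₁.eventually_lt_const (by positivity)
  filter_upwards [e₃, e₄] with y h₃ h₄
  have h₅ : ‖(Φ.map (evalRingHom y)).eval x‖ <
      ‖(Φ.map (evalRingHom y)).derivative.eval x‖ ^ 2 := by
    rw [hd]
    exact (h₄.trans_le (min_le_left _ _)).trans (by gcongr)
  obtain ⟨z, hz, hzx⟩ := exists_root_norm_sub_mul_eq h₅
  refine ⟨z, hz, ?_⟩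
  rw [hd] at hzx
  have h₆ := hzx ▸ h₄.trans_le (min_le_right _ _)
  have h₇ : ‖z - x‖ * (d / 2) ≤ ‖z - x‖ * ‖(Φ.derivative.map (evalRingHom y)).eval x‖ := by gcongr
  exact lt_of_mul_lt_mul_right (h₇.trans_lt h₆) (by positivity)

end Padic

/-! ### The square-free part. -/

section SquareFree

theorem maxSquareDivisor_sq_dvd (a : ℤ) : (maxSquareDivisor a : ℤ) ^ 2 ∣ a := by
  rcases eq_or_ne a 0 with rfl | ha
  · simp
  · exact Nat.findGreatest_spec (P := fun b => (b : ℤ) ^ 2 ∣ a) (m := 1)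
      (Int.natAbs_pos.mpr ha) (by simp)

theorem squareFreePart_mul (a : ℤ) : squareFreePart a * (maxSquareDivisor a : ℤ) ^ 2 = a :=
  Int.ediv_mul_cancel (maxSquareDivisor_sq_dvd a)

/-- The search bound `|a|` loses nothing, because `b ≤ b² ≤ |a|`. -/
theorem le_maxSquareDivisor {a : ℤ} (ha : a ≠ 0) {b : ℕ} (hb : (b : ℤ) ^ 2 ∣ a) :
    b ≤ maxSquareDivisor a := by
  refine Nat.le_findGreatest (P := fun b => (b : ℤ) ^ 2 ∣ a) ?_ hb
  have h := Int.natAbs_dvd_natAbs.mpr hb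
  rw [Int.natAbs_pow, Int.natAbs_natCast] at h
  exact (Nat.le_self_pow two_ne_zero b).trans (Nat.le_of_dvd (Int.natAbs_pos.mpr ha) h)

theorem sq_not_dvd_squareFreePart {a : ℤ} (ha : a ≠ 0) {q : ℕ} (hq : 1 < q) :
    ¬ (q : ℤ) ^ 2 ∣ squareFreePart a := by
  intro h
  have h₁ : ((q * maxSquareDivisor a : ℕ) : ℤ) ^ 2 ∣ a := by
    conv_rhs => rw [← squareFreePart_mul a]
    push_cast
    rw [mul_pow]
    exact mul_dvd_mul_right h _
  have h₂ := le_maxSquareDivisor ha h₁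
  have h₃ : 0 < maxSquareDivisor a := Nat.pos_of_ne_zero fun h0 => by
    have := squareFreePart_mul a
    simp [h0] at this
    exact ha this.symm
  nlinarith

end SquareFree

/-! ### Solving `1 + m(x² - 4) = 0` in `ℤ_p`. -/

section Arithmetic

variable {p : ℕ} [Fact p.Prime]

theorem isUnit_intCast_of_not_dvd {m : ℤ} (h : ¬ (p : ℤ) ∣ m) : IsUnit (m : ℤ_[p]) := by
  rw [PadicInt.isUnit_iff]
  refine le_antisymm (PadicInt.norm_le_one _) (not_lt.mp fun h' => h ?_)
  exact (PadicInt.norm_int_lt_one_iff_dvd m).mp h'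

/-- Hensel for `X² - D`. The factor `2` stays in the bound so that `p = 2` is covered too. -/
theorem exists_sq_eq_of_norm_lt {D a : ℤ_[p]} (h : ‖a ^ 2 - D‖ < ‖2 * a‖ ^ 2) :
    ∃ z : ℤ_[p], z ^ 2 = D := by
  obtain ⟨z, hz, -⟩ := exists_root_norm_sub_mul_eq (F := X ^ 2 - C D) (a := a)
    (by simpa [one_add_one_eq_two] using h)
  exact ⟨z, by simpa [sub_eq_zero] using hz⟩

theorem isSquare_padicInt_of_isSquare_zmod (hp : p ≠ 2) {r : ℤ} (hr : (r : ZMod p) ≠ 0)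
    (h : IsSquare (r : ZMod p)) : ∃ z : ℤ_[p], z ^ 2 = r := by
  obtain ⟨t, ht⟩ := h
  obtain ⟨a, rfl⟩ := ZMod.intCast_surjective t
  have h₁ : (p : ℤ) ∣ a ^ 2 - r := by
    rw [← ZMod.intCast_zmod_eq_zero_iff_dvd]
    push_cast
    rw [ht]; ring
  have h₂ : ¬ (p : ℤ) ∣ 2 * a := by
    rw [← ZMod.intCast_zmod_eq_zero_iff_dvd]
    push_cast
    intro h0
    rcases mul_eq_zero.mp h0 with h0 | h0
    · exact Ring.two_ne_zero (by rwa [ZMod.ringChar_zmod_n]) h0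
    · rw [h0] at ht
      simp [ht] at hr
  refine exists_sq_eq_of_norm_lt (a := (a : ℤ_[p])) ?_
  have h₃ := (PadicInt.norm_int_lt_one_iff_dvd (p := p) _).mpr h₁
  have h₄ := PadicInt.isUnit_iff.mp (isUnit_intCast_of_not_dvd h₂)
  push_cast at h₃ h₄
  rw [h₄]
  simpa using h₃

theorem isSquare_padicInt_two {D : ℤ} (h : D ≡ 1 [ZMOD 8]) : ∃ z : ℤ_[2], z ^ 2 = D := by
  refine exists_sq_eq_of_norm_lt (a := 1) ?_
  -- At the approximate root `1`, the congruence gives `‖1 - D‖ ≤ 1/8`, below `‖2‖² = 1/4`.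
  have h₁ : ((2 : ℕ) ^ 3 : ℤ) ∣ 1 - D := by simpa using h.dvd
  have h₂ := (PadicInt.norm_int_le_pow_iff_dvd (p := 2) (k := 1 - D) (n := 3)).mpr (by exact_mod_cast h₁)
  push_cast at h₂
  have h₃ : ‖(2 : ℤ_[2])‖ = 2⁻¹ := by simpa using PadicInt.norm_p (p := 2)
  rw [mul_one, h₃, one_pow]
  refine h₂.trans_lt ?_
  norm_num

/-- For which `p` the Alexander polynomial has a root with `p`-adically integral trace. -/
theorem exists_padicInt_root_iff {m : ℤ} (hm : m ≠ 0) :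
    (∃ x : ℤ_[p], 1 + (m : ℤ_[p]) * (x ^ 2 - 4) = 0) ↔
      ((p = 2 ∧ 4 * m ^ 2 - m ≡ 1 [ZMOD 8]) ∨
        (p ≠ 2 ∧ ¬ (p : ℤ) ∣ m ∧ legendreSym p (squareFreePart (4 * m ^ 2 - m)) = 1)) := by
  have hD : 4 * m ^ 2 - m ≠ 0 := by
    intro h
    have : m * (4 * m - 1) = 0 := by linear_combination h
    rcases mul_eq_zero.mp this with h | h <;> omega
  -- With `u = m⁻¹`, a square root `z` of `4m² - m` yields `x = z / m`.
  have key (hpm : ¬ (p : ℤ) ∣ m) (h : ∃ z : ℤ_[p], z ^ 2 = ((4 * m ^ 2 - m : ℤ) : ℤ_[p])) :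
      ∃ x : ℤ_[p], 1 + (m : ℤ_[p]) * (x ^ 2 - 4) = 0 := by
    obtain ⟨z, hz⟩ := h
    obtain ⟨u, hu⟩ := (isUnit_intCast_of_not_dvd hpm).exists_right_inv
    push_cast at hz
    refine ⟨z * u, ?_⟩
    linear_combination (m * u ^ 2) * hz + (4 * m * (m * u + 1) - m * u - 1) * hu
  constructor
  · rintro ⟨x, hx⟩
    rcases eq_or_ne p 2 with rfl | hp
    · left
      refine ⟨rfl, ?_⟩
      have h := congrArg (PadicInt.toZModPow 3) hx
      simp only [map_add, map_one, map_mul, map_sub, map_pow, map_intCast, map_ofNat, map_zero] at h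
      -- The condition modulo 8 is a finite check in `ℤ/8`.
      have dec : ∀ m t : ZMod (2 ^ 3), 1 + m * (t ^ 2 - 4) = 0 → 4 * m ^ 2 - m = 1 := by decide
      have h' := dec _ _ h
      refine (ZMod.intCast_eq_intCast_iff _ _ 8).mp ?_
      push_cast
      exact h'
    · right
      have hpm : ¬ (p : ℤ) ∣ m := by
        intro hdvd
        have h := congrArg PadicInt.toZMod hx
        simp only [map_add, map_one, map_mul, map_intCast, map_zero] at h
        rw [(ZMod.intCast_zmod_eq_zero_iff_dvd _ _).mpr hdvd] at h
        simp at h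
      refine ⟨hp, hpm, ?_⟩
      set D := 4 * m ^ 2 - m with hDdef
      set r := squareFreePart D with hr
      set b := maxSquareDivisor D with hb
      have hrb : r * (b : ℤ) ^ 2 = D := squareFreePart_mul D
      have hrb' : (r : ℤ_[p]) * (b : ℤ_[p]) ^ 2 = (m * x) ^ 2 := by
        have := congrArg (Int.cast : ℤ → ℤ_[p]) hrb
        push_cast [hDdef] at this
        rw [this]
        linear_combination (-(m : ℤ_[p])) * hx
      have hb0 : b ≠ 0 := fun h => hD (by rw [← hrb, h]; simp)
      have hb0' : (b : ℤ_[p]) ≠ 0 := Nat.cast_ne_zero.mpr hb0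
      -- `b` divides `m x` since `b²` divides `(m x)²` in a valuation ring
      have hdvd : (b : ℤ_[p]) ∣ m * x := by
        have : (b : ℤ_[p]) ^ 2 ∣ (m * x) ^ 2 := ⟨r, by rw [← hrb']; ring⟩
        exact (IsIntegrallyClosed.pow_dvd_pow_iff two_ne_zero).mp this
      obtain ⟨t, ht⟩ := hdvd
      have hrt : (r : ℤ_[p]) = t ^ 2 := by
        have h : (b : ℤ_[p]) ^ 2 * r = (b : ℤ_[p]) ^ 2 * t ^ 2 := by
          rw [mul_comm, hrb', ht]; ring
        exact mul_left_cancel₀ (pow_ne_zero 2 hb0') h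
      have hsq : (r : ZMod p) = PadicInt.toZMod t ^ 2 := by
        have := congrArg PadicInt.toZMod hrt
        simpa using this
      -- If `p ∣ r = t²` then `p ∣ t`, so `p² ∣ r`, against square-freeness. This excludes the
      -- Legendre symbol `0`.
      have hr0 : (r : ZMod p) ≠ 0 := by
        intro h0
        have ht0 : PadicInt.toZMod t = 0 := by
          rw [h0] at hsq
          exact pow_eq_zero_iff two_ne_zero |>.mp hsq.symm
        have hpt : (p : ℤ_[p]) ∣ t := by
          have : t ∈ RingHom.ker (PadicInt.toZMod (p := p)) := ht0
          rw [PadicInt.ker_toZMod, PadicInt.maximalIdeal_eq_span_p,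
            Ideal.mem_span_singleton] at this
          exact this
        refine sq_not_dvd_squareFreePart hD (Fact.out : p.Prime).one_lt ?_
        have h2 : (p : ℤ_[p]) ^ 2 ∣ (r : ℤ_[p]) := hrt ▸ pow_dvd_pow_of_dvd hpt 2
        exact_mod_cast (PadicInt.pow_p_dvd_int_iff 2 r).mp h2
      rw [legendreSym.eq_one_iff p hr0, hsq]
      exact IsSquare.sq _
  · rintro (⟨rfl, h⟩ | ⟨hp, hpm, h⟩)
    · refine key ?_ (isSquare_padicInt_two h)
      -- An even `m` would make `4m² - m` even, not `1` modulo 8.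
      rintro ⟨c, rfl⟩
      have := h.dvd
      push_cast at this
      ring_nf at this
      omega
    · refine key hpm ?_
      set D := 4 * m ^ 2 - m with hDdef
      have hr0 : ((squareFreePart D : ℤ) : ZMod p) ≠ 0 := by
        intro h0
        rw [(legendreSym.eq_zero_iff p _).mpr h0] at h
        exact zero_ne_one h
      obtain ⟨z, hz⟩ := isSquare_padicInt_of_isSquare_zmod hp hr0
        ((legendreSym.eq_one_iff p hr0).mp h)
      refine ⟨z * maxSquareDivisor D, ?_⟩
      conv_rhs => rw [← squareFreePart_mul D]
      push_cast
      rw [mul_pow, hz]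

end Arithmetic

/-! ### Reducibility as a common eigenvector. -/

section Irreducibility

variable {G R : Type} [Group G] [CommRing R] [IsDomain R]

/-- The matrix of `g` over the algebraic closure of the fraction field. -/
noncomputable abbrev geometricMatrix (A : SL(2, R)) :
    Matrix (Fin 2) (Fin 2) (AlgebraicClosure (FractionRing R)) :=
  (A : Matrix (Fin 2) (Fin 2) R).map (algebraMap R (AlgebraicClosure (FractionRing R)))

theorem geometricRep_apply (ρ : G →* SL(2, R)) (g : G)
    (v : Fin 2 → AlgebraicClosure (FractionRing R)) :
    geometricRep ρ g v = (geometricMatrix (ρ g)).mulVec v := by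
  simp [geometricRep, Matrix.toLin'_apply]

theorem algebraMap_geometric_injective :
    Function.Injective (algebraMap R (AlgebraicClosure (FractionRing R))) := by
  rw [IsScalarTower.algebraMap_eq R (FractionRing R) (AlgebraicClosure (FractionRing R))]
  exact (algebraMap (FractionRing R) _).injective.comp (IsFractionRing.injective R _)

/-- In dimension two a proper nonzero subrepresentation is a line. -/
theorem not_isAbsIrreducibleRep_iff (ρ : G →* SL(2, R)) :
    ¬ IsAbsIrreducibleRep ρ ↔ ∃ v : Fin 2 → AlgebraicClosure (FractionRing R), v ≠ 0 ∧
      ∀ g, ∃ c : AlgebraicClosure (FractionRing R),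
        (geometricMatrix (ρ g)).mulVec v = c • v := by
  set K := AlgebraicClosure (FractionRing R)
  have hfin : Module.finrank K (Fin 2 → K) = 2 := by simp
  constructor
  · intro h
    have hnt : Nontrivial (Subrepresentation (geometricRep ρ)) := by
      refine ⟨⊥, ⊤, fun h => ?_⟩
      have := congrArg Subrepresentation.toSubmodule h
      exact bot_ne_top (α := Submodule K (Fin 2 → K)) this
    have : ∃ W : Subrepresentation (geometricRep ρ), W ≠ ⊥ ∧ W ≠ ⊤ := by
      by_contra! hW
      exact h ⟨fun W => or_iff_not_imp_left.mpr (hW W)⟩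
    obtain ⟨W, hbot, htop⟩ := this
    have hbot' : W.toSubmodule ≠ ⊥ :=
      fun h => hbot (Subrepresentation.toSubmodule_injective h)
    have htop' : W.toSubmodule ≠ ⊤ :=
      fun h => htop (Subrepresentation.toSubmodule_injective h)
    obtain ⟨v, hv, hv0⟩ := Submodule.exists_mem_ne_zero_of_ne_bot hbot'
    have h₁ : Module.finrank K W.toSubmodule = 1 :=
      le_antisymm (Nat.lt_succ_iff.mp ((Submodule.finrank_lt htop').trans_eq hfin))
        (Submodule.one_le_finrank_iff.mpr hbot')
    refine ⟨v, hv0, fun g => ?_⟩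
    have hgv := W.apply_mem_toSubmodule g hv
    rw [geometricRep_apply] at hgv
    obtain ⟨c, hc⟩ := (finrank_eq_one_iff_of_nonzero' (⟨v, hv⟩ : W.toSubmodule)
      (by simpa using hv0)).mp h₁ ⟨_, hgv⟩
    exact ⟨c, (congrArg Subtype.val hc).symm⟩
  · rintro ⟨v, hv0, hv⟩ hirr
    let W : Subrepresentation (geometricRep ρ) :=
      { toSubmodule := Submodule.span K {v}
        apply_mem_toSubmodule := by
          intro g u hu
          obtain ⟨c, rfl⟩ := Submodule.mem_span_singleton.mp hu
          obtain ⟨d, hd⟩ := hv g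
          rw [map_smul, geometricRep_apply, hd]
          exact Submodule.smul_mem _ _ (Submodule.smul_mem _ _ (Submodule.mem_span_singleton_self v)) }
    have hW : Module.finrank K W.toSubmodule = 1 := finrank_span_singleton hv0
    rcases hirr.eq_bot_or_eq_top W with h | h
    · have h' : W.toSubmodule = ⊥ := congrArg Subrepresentation.toSubmodule h
      rw [h', finrank_bot] at hW
      exact zero_ne_one hW
    · have h' : W.toSubmodule = ⊤ := congrArg Subrepresentation.toSubmodule h
      rw [h', finrank_top, hfin] at hW
      omega

theorem geometricMatrix_mul (A B : SL(2, R)) :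
    geometricMatrix (A * B) = geometricMatrix A * geometricMatrix B := by
  simp [geometricMatrix, Matrix.map_mul]

theorem geometricMatrix_one : geometricMatrix (1 : SL(2, R)) = 1 := by
  simp [geometricMatrix]

theorem geometricMatrix_mulVec_ne_zero (A : SL(2, R))
    {v : Fin 2 → AlgebraicClosure (FractionRing R)} (hv : v ≠ 0) :
    (geometricMatrix A).mulVec v ≠ 0 := by
  intro h
  apply hv
  have := congrArg (geometricMatrix A⁻¹).mulVec h
  rwa [Matrix.mulVec_mulVec, ← geometricMatrix_mul, inv_mul_cancel, geometricMatrix_one,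
    Matrix.one_mulVec, Matrix.mulVec_zero] at this

/-- A common eigenvector of a generating set makes a representation reducible. -/
theorem not_isAbsIrreducibleRep_of_closure (ρ : G →* SL(2, R)) {S : Set G}
    (hS : Subgroup.closure S = ⊤) {v : Fin 2 → AlgebraicClosure (FractionRing R)} (hv0 : v ≠ 0)
    (hv : ∀ g ∈ S, ∃ c : AlgebraicClosure (FractionRing R),
      (geometricMatrix (ρ g)).mulVec v = c • v) : ¬ IsAbsIrreducibleRep ρ := by
  refine (not_isAbsIrreducibleRep_iff ρ).mpr ⟨v, hv0, fun g => ?_⟩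
  have hg : g ∈ Subgroup.closure S := hS ▸ Subgroup.mem_top g
  induction hg using Subgroup.closure_induction with
  | mem g hg => exact hv g hg
  | one => exact ⟨1, by rw [map_one, geometricMatrix_one, Matrix.one_mulVec, one_smul]⟩
  | mul g h _ _ hg hh =>
    obtain ⟨c, hc⟩ := hg
    obtain ⟨d, hd⟩ := hh
    exact ⟨d * c, by rw [map_mul, geometricMatrix_mul, ← Matrix.mulVec_mulVec, hd,
      Matrix.mulVec_smul, hc, smul_smul]⟩
  | inv g _ hg =>
    obtain ⟨c, hc⟩ := hg
    have hc0 : c ≠ 0 := by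
      rintro rfl
      exact geometricMatrix_mulVec_ne_zero (ρ g) hv0 (by rw [hc, zero_smul])
    refine ⟨c⁻¹, ?_⟩
    have h := congrArg (geometricMatrix (ρ g⁻¹)).mulVec hc
    rw [Matrix.mulVec_mulVec, ← geometricMatrix_mul, ← map_mul, inv_mul_cancel, map_one,
      geometricMatrix_one, Matrix.one_mulVec, Matrix.mulVec_smul] at h
    conv_rhs => rw [h]
    rw [smul_smul, inv_mul_cancel₀ hc0, one_smul]

end Irreducibility

/-! ### Traces of words as functions of `(x, y)`. -/

section Words

theorem trace_mul_of_trace_mul_inv {R : Type*} [CommRing R] {A B : SL(2, R)} {x y : R}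
    (hA : (A : Matrix (Fin 2) (Fin 2) R).trace = x) (hB : (B : Matrix (Fin 2) (Fin 2) R).trace = x)
    (hy : ((B * A⁻¹ : SL(2, R)) : Matrix (Fin 2) (Fin 2) R).trace = y) :
    ((A : Matrix (Fin 2) (Fin 2) R) * (B : Matrix (Fin 2) (Fin 2) R)).trace = x ^ 2 - y := by
  rw [Matrix.SpecialLinearGroup.coe_mul, SL2_coe_inv, mul_sub, mul_smul_comm, mul_one,
    Matrix.trace_sub, Matrix.trace_smul, hA, hB, Matrix.trace_mul_comm, smul_eq_mul] at hy
  rw [← hy]; ring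

/-- Every word in two matrices of `SL₂` with common trace `x` is a combination of `1, A, B, AB`
whose coefficients depend continuously on `x` and `y = tr (B A⁻¹)`. -/
theorem exists_word_coeffs (S : Type) [CommRing S] [TopologicalSpace S] [IsTopologicalRing S]
    (g : FreeGroup (Fin 2)) :
    ∃ c₀ c₁ c₂ c₃ : S × S → S,
      Continuous c₀ ∧ Continuous c₁ ∧ Continuous c₂ ∧ Continuous c₃ ∧
      ∀ (R : Type) (_ : CommRing R) (_ : Algebra S R) (f : FreeGroup (Fin 2) →* SL(2, R)) (x y : S),
        (f DoubleTwist.a : Matrix (Fin 2) (Fin 2) R).trace = algebraMap S R x →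
        (f DoubleTwist.b : Matrix (Fin 2) (Fin 2) R).trace = algebraMap S R x →
        ((f DoubleTwist.b * (f DoubleTwist.a)⁻¹ : SL(2, R)) : Matrix (Fin 2) (Fin 2) R).trace =
          algebraMap S R y →
        (f g : Matrix (Fin 2) (Fin 2) R) =
          algebraMap S R (c₀ (x, y)) • (1 : Matrix (Fin 2) (Fin 2) R) +
            algebraMap S R (c₁ (x, y)) • (f DoubleTwist.a : Matrix (Fin 2) (Fin 2) R) +
            algebraMap S R (c₂ (x, y)) • (f DoubleTwist.b : Matrix (Fin 2) (Fin 2) R) +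
            algebraMap S R (c₃ (x, y)) • ((f DoubleTwist.a : Matrix (Fin 2) (Fin 2) R) *
              (f DoubleTwist.b : Matrix (Fin 2) (Fin 2) R)) := by
  induction g using FreeGroup.induction_on with
  | C1 =>
    refine ⟨1, 0, 0, 0, continuous_one, continuous_zero, continuous_zero, continuous_zero, ?_⟩
    intros
    simp
  | of i =>
    fin_cases i
    · refine ⟨0, 1, 0, 0, continuous_zero, continuous_one, continuous_zero, continuous_zero, ?_⟩
      intros
      simp [DoubleTwist.a]
    · refine ⟨0, 0, 1, 0, continuous_zero, continuous_zero, continuous_one, continuous_zero, ?_⟩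
      intros
      simp [DoubleTwist.b]
  | inv_of i h =>
    obtain ⟨c₀, c₁, c₂, c₃, h₀, h₁, h₂, h₃, h⟩ := h
    refine ⟨fun q => c₀ q + c₁ q * q.1 + c₂ q * q.1 + c₃ q * (q.1 ^ 2 - q.2), -c₁, -c₂, -c₃,
      by fun_prop, h₁.neg, h₂.neg, h₃.neg, ?_⟩
    intro R _ _ f x y hA hB hy
    rw [map_inv, SL2_coe_inv, h R _ _ f x y hA hB hy]
    simp only [Matrix.trace_add, Matrix.trace_smul, trace_mul_of_trace_mul_inv hA hB hy, hA, hB,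
      Matrix.trace_one, Fintype.card_fin, map_add, map_mul, map_sub, map_pow, Pi.neg_apply, map_neg,
      smul_eq_mul, Nat.cast_ofNat]
    module
  | mul g h hg hh =>
    obtain ⟨c₀, c₁, c₂, c₃, hc₀, hc₁, hc₂, hc₃, hc⟩ := hg
    obtain ⟨d₀, d₁, d₂, d₃, hd₀, hd₁, hd₂, hd₃, hd⟩ := hh
    -- These are the structure constants for the spanning set `1, A, B, AB`, obtained from
    -- Cayley–Hamilton and the rule for `BA` below. They do not depend on `R` or `f`.
    refine ⟨fun q => c₀ q * d₀ q - c₁ q * d₁ q - c₂ q * d₂ q - c₃ q * d₃ q - q.2 * (c₂ q * d₁ q)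
          - q.1 * (c₃ q * d₁ q) - q.1 * (c₂ q * d₃ q),
      fun q => c₀ q * d₁ q + c₁ q * d₀ q + q.1 * (c₁ q * d₁ q) + q.1 * (c₂ q * d₁ q)
          + (q.1 ^ 2 - q.2) * (c₃ q * d₁ q) - c₃ q * d₂ q + c₂ q * d₃ q,
      fun q => c₀ q * d₂ q + c₂ q * d₀ q + q.1 * (c₂ q * d₂ q) + q.1 * (c₂ q * d₁ q)
          + c₃ q * d₁ q - c₁ q * d₃ q + (q.1 ^ 2 - q.2) * (c₂ q * d₃ q),
      fun q => c₀ q * d₃ q + c₃ q * d₀ q + c₁ q * d₂ q - c₂ q * d₁ q + q.1 * (c₃ q * d₂ q)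
          + q.1 * (c₁ q * d₃ q) + (q.1 ^ 2 - q.2) * (c₃ q * d₃ q),
      by fun_prop, by fun_prop, by fun_prop, by fun_prop, ?_⟩
    intro R _ _ f x y hA hB hy
    rw [map_mul, Matrix.SpecialLinearGroup.coe_mul, hc R _ _ f x y hA hB hy,
      hd R _ _ f x y hA hB hy]
    have hAA := SL2_sq (f DoubleTwist.a)
    have hBB := SL2_sq (f DoubleTwist.b)
    -- The rule comes from `B A⁻¹ + A B⁻¹ = y`, after eliminating the inverses.
    have hBA : (f DoubleTwist.b : Matrix (Fin 2) (Fin 2) R) * (f DoubleTwist.a : Matrix _ _ R) =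
        algebraMap S R x • (f DoubleTwist.a : Matrix (Fin 2) (Fin 2) R) +
          algebraMap S R x • (f DoubleTwist.b : Matrix (Fin 2) (Fin 2) R) -
          algebraMap S R y • (1 : Matrix (Fin 2) (Fin 2) R) -
          (f DoubleTwist.a : Matrix (Fin 2) (Fin 2) R) *
            (f DoubleTwist.b : Matrix (Fin 2) (Fin 2) R) := by
      have h := SL2_coe_inv (f DoubleTwist.b * (f DoubleTwist.a)⁻¹)
      rw [hy, mul_inv_rev, inv_inv, Matrix.SpecialLinearGroup.coe_mul,
        Matrix.SpecialLinearGroup.coe_mul, SL2_coe_inv, SL2_coe_inv, hA, hB, mul_sub, mul_sub,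
        mul_smul_comm, mul_smul_comm, mul_one, mul_one] at h
      rw [sub_eq_iff_eq_add] at h
      rw [h]
      abel
    rw [hA] at hAA
    rw [hB] at hBB
    simp only [map_add, map_mul, map_sub, map_pow]
    generalize (f DoubleTwist.a : Matrix (Fin 2) (Fin 2) R) = A at hAA hBA ⊢
    generalize (f DoubleTwist.b : Matrix (Fin 2) (Fin 2) R) = B at hBB hBA ⊢
    have hAAB : A * (A * B) = algebraMap S R x • (A * B) - B := by
      rw [← mul_assoc, hAA, sub_mul, smul_mul_assoc, one_mul]
    have hABB : A * B * B = algebraMap S R x • (A * B) - A := by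
      rw [mul_assoc, hBB, mul_sub, mul_smul_comm, mul_one]
    have hABA : A * B * A = (algebraMap S R x ^ 2 - algebraMap S R y) • A + B -
        algebraMap S R x • (1 : Matrix (Fin 2) (Fin 2) R) := by
      rw [mul_assoc, hBA]
      simp only [mul_sub, mul_add, mul_smul_comm, hAA, hAAB, mul_one]
      module
    have hBAB : B * (A * B) = (algebraMap S R x ^ 2 - algebraMap S R y) • B + A -
        algebraMap S R x • (1 : Matrix (Fin 2) (Fin 2) R) := by
      rw [← mul_assoc, hBA]
      simp only [sub_mul, add_mul, smul_mul_assoc, hBB, hABB, one_mul]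
      module
    have hABAB : A * B * (A * B) = (algebraMap S R x ^ 2 - algebraMap S R y) • (A * B) -
        (1 : Matrix (Fin 2) (Fin 2) R) := by
      rw [← mul_assoc, hABA]
      simp only [sub_mul, add_mul, smul_mul_assoc, hBB, one_mul]
      module
    simp only [add_mul, mul_add, smul_mul_assoc, mul_smul_comm, one_mul, mul_one, hAA, hBB, hBA,
      hAAB, hABB, hABA, hBAB, hABAB]
    module

/-- The trace of a word is a continuous function of `x = tr A = tr B` and `y = tr (B A⁻¹)`. -/
theorem exists_word_trace (S : Type) [CommRing S] [TopologicalSpace S] [IsTopologicalRing S]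
    (g : FreeGroup (Fin 2)) :
    ∃ P : S × S → S, Continuous P ∧
      ∀ (R : Type) (_ : CommRing R) (_ : Algebra S R) (f : FreeGroup (Fin 2) →* SL(2, R)) (x y : S),
        (f DoubleTwist.a : Matrix (Fin 2) (Fin 2) R).trace = algebraMap S R x →
        (f DoubleTwist.b : Matrix (Fin 2) (Fin 2) R).trace = algebraMap S R x →
        ((f DoubleTwist.b * (f DoubleTwist.a)⁻¹ : SL(2, R)) : Matrix (Fin 2) (Fin 2) R).trace =
          algebraMap S R y →
        (f g : Matrix (Fin 2) (Fin 2) R).trace = algebraMap S R (P (x, y)) := by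
  obtain ⟨c₀, c₁, c₂, c₃, h₀, h₁, h₂, h₃, h⟩ := exists_word_coeffs S g
  refine ⟨fun q => 2 * c₀ q + c₁ q * q.1 + c₂ q * q.1 + c₃ q * (q.1 ^ 2 - q.2), by fun_prop, ?_⟩
  intro R _ _ f x y hA hB hy
  rw [h R _ _ f x y hA hB hy]
  simp only [Matrix.trace_add, Matrix.trace_smul, trace_mul_of_trace_mul_inv hA hB hy, hA,
    hB, Matrix.trace_one, Fintype.card_fin,
    map_add, map_mul, map_sub, map_pow, map_ofNat, smul_eq_mul, Nat.cast_ofNat]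
  ring

end Words

/-! ### Representations of the knot group. -/

section KnotGroup

variable {k l : ℤ} {R : Type} [CommRing R]

/-- The canonical map from words to the knot group. -/
def knotMk (k l : ℤ) : FreeGroup (Fin 2) →* DoubleTwistKnotGroup k l := PresentedGroup.mk _

theorem knotMk_surjective : Function.Surjective (knotMk k l) := PresentedGroup.mk_surjective _

theorem closure_meridians :
    Subgroup.closure {knotMk k l DoubleTwist.a, knotMk k l DoubleTwist.b} = ⊤ := by
  rw [← PresentedGroup.closure_range_of]
  congr 1
  ext g
  simp only [Set.mem_insert_iff, Set.mem_singleton_iff, Set.mem_range, Fin.exists_fin_two]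
  exact or_congr eq_comm eq_comm

theorem map_word (f : FreeGroup (Fin 2) →* SL(2, R)) (k : ℤ) :
    f (DoubleTwist.w k) = slW k (f DoubleTwist.a) (f DoubleTwist.b) := by
  simp [DoubleTwist.w, slW]

theorem knot_relation (ρ : DoubleTwistKnotGroup k l →* SL(2, R)) :
    slW k (ρ (knotMk k l DoubleTwist.a)) (ρ (knotMk k l DoubleTwist.b)) ^ l *
        ρ (knotMk k l DoubleTwist.a) =
      ρ (knotMk k l DoubleTwist.b) *
        slW k (ρ (knotMk k l DoubleTwist.a)) (ρ (knotMk k l DoubleTwist.b)) ^ l := by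
  have h : knotMk k l (DoubleTwist.w k ^ l * DoubleTwist.a *
      (DoubleTwist.b * DoubleTwist.w k ^ l)⁻¹) = 1 :=
    PresentedGroup.one_of_mem (Set.mem_singleton _)
  have hw := map_word (ρ.comp (knotMk k l)) k
  simp only [MonoidHom.comp_apply] at hw
  rw [map_mul, map_inv, mul_inv_eq_one] at h
  simpa [hw] using congrArg ρ h

/-- The relation says that `wˡ` conjugates `a` to `b`. -/
theorem trace_meridian_eq (ρ : DoubleTwistKnotGroup k l →* SL(2, R)) :
    (ρ (knotMk k l DoubleTwist.b) : Matrix (Fin 2) (Fin 2) R).trace =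
      (ρ (knotMk k l DoubleTwist.a) : Matrix (Fin 2) (Fin 2) R).trace := by
  have h := knot_relation ρ
  set W := slW k (ρ (knotMk k l DoubleTwist.a)) (ρ (knotMk k l DoubleTwist.b)) ^ l
  rw [eq_mul_inv_of_mul_eq h.symm, mul_assoc, Matrix.SpecialLinearGroup.coe_mul,
    Matrix.trace_mul_comm, ← Matrix.SpecialLinearGroup.coe_mul, inv_mul_cancel_right]

theorem exists_knot_rep {A B : SL(2, R)} {x y : R}
    (hA : (A : Matrix (Fin 2) (Fin 2) R).trace = x) (hB : (B : Matrix (Fin 2) (Fin 2) R).trace = x)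
    (hy : ((B * A⁻¹ : SL(2, R)) : Matrix (Fin 2) (Fin 2) R).trace = y)
    (h : rileyPoly k l x y = 0) :
    ∃ ρ : DoubleTwistKnotGroup k l →* SL(2, R),
      ρ (knotMk k l DoubleTwist.a) = A ∧ ρ (knotMk k l DoubleTwist.b) = B := by
  let f : Fin 2 → SL(2, R) := ![A, B]
  have ha : FreeGroup.lift f DoubleTwist.a = A := by simp [DoubleTwist.a, f]
  have hb : FreeGroup.lift f DoubleTwist.b = B := by simp [DoubleTwist.b, f]
  have hrel : ∀ r ∈ ({DoubleTwist.w k ^ l * DoubleTwist.a *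
      (DoubleTwist.b * DoubleTwist.w k ^ l)⁻¹} : Set (FreeGroup (Fin 2))),
      FreeGroup.lift f r = 1 := by
    rintro r rfl
    rw [map_mul, map_inv, mul_inv_eq_one, map_mul, map_mul, map_zpow, map_word, ha, hb]
    apply Matrix.SpecialLinearGroup.coeMonoidHom_injective
    rw [Matrix.SpecialLinearGroup.coeMonoidHom_apply, Matrix.SpecialLinearGroup.coeMonoidHom_apply,
      ← sub_eq_zero, slW_zpow_mul_sub_mul k l hA hB hy, h, zero_smul]
  exact ⟨PresentedGroup.toGroup hrel, ha, hb⟩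

end KnotGroup

/-! ### Constraints on reducible and irreducible representations. -/

section Reducible

variable {k l : ℤ} {R : Type} [CommRing R] [IsDomain R]

/-- On a common eigenvector the relation forces `a` and `b` to have the same eigenvalue. So `b a⁻¹`
has eigenvalue `1` and determinant `1`, hence trace `2`. -/
theorem trace_eq_two_of_not_irreducible (ρ : DoubleTwistKnotGroup k l →* SL(2, R))
    (h : ¬ IsAbsIrreducibleRep ρ) :
    ((ρ (knotMk k l DoubleTwist.b) * (ρ (knotMk k l DoubleTwist.a))⁻¹ : SL(2, R)) :
      Matrix (Fin 2) (Fin 2) R).trace = 2 := by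
  obtain ⟨v, hv0, hv⟩ := (not_isAbsIrreducibleRep_iff ρ).mp h
  have hrel := knot_relation ρ
  have hw := map_word (ρ.comp (knotMk k l)) k
  simp only [MonoidHom.comp_apply] at hw
  rw [← hw, ← map_zpow, ← map_zpow] at hrel
  obtain ⟨α, hα⟩ := hv (knotMk k l DoubleTwist.a)
  obtain ⟨β, hβ⟩ := hv (knotMk k l DoubleTwist.b)
  obtain ⟨γ, hγ⟩ := hv (knotMk k l (DoubleTwist.w k ^ l))
  have hγ0 : γ ≠ 0 := by
    rintro rfl
    exact geometricMatrix_mulVec_ne_zero _ hv0 (by rw [hγ, zero_smul])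
  have hαβ : α = β := by
    have h₁ := congrArg (fun M => (geometricMatrix M).mulVec v) hrel
    simp only [geometricMatrix_mul, ← Matrix.mulVec_mulVec, hα, hγ, hβ, Matrix.mulVec_smul,
      smul_smul] at h₁
    have h₂ := smul_left_injective _ hv0 h₁
    exact mul_right_cancel₀ hγ0 (h₂.trans (mul_comm _ _))
  set A := ρ (knotMk k l DoubleTwist.a)
  set B := ρ (knotMk k l DoubleTwist.b)
  have hα0 : α ≠ 0 := by
    rintro rfl
    exact geometricMatrix_mulVec_ne_zero _ hv0 (by rw [hα, zero_smul])
  have hfix : (geometricMatrix (B * A⁻¹)).mulVec v = v := by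
    have h₁ : (geometricMatrix (B * A⁻¹)).mulVec (α • v) = α • v := by
      conv_lhs => rw [← hα]
      rw [Matrix.mulVec_mulVec, ← geometricMatrix_mul, inv_mul_cancel_right, hβ, hαβ]
    rw [Matrix.mulVec_smul] at h₁
    exact smul_right_injective _ hα0 h₁
  have hdet : (geometricMatrix (B * A⁻¹) - 1).det = 0 :=
    Matrix.exists_mulVec_eq_zero_iff.mp ⟨v, hv0, by
      rw [Matrix.sub_mulVec, hfix, Matrix.one_mulVec, sub_self]⟩
  have hone := (B * A⁻¹).det_coe
  apply algebraMap_geometric_injective (R := R)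
  have hone' := congrArg (algebraMap R (AlgebraicClosure (FractionRing R))) hone
  rw [Matrix.det_fin_two] at hdet hone'
  rw [Matrix.trace_fin_two]
  simp only [map_sub, map_mul, map_one, Matrix.sub_apply, Matrix.map_apply, Matrix.one_apply_eq,
    geometricMatrix, ne_eq, zero_ne_one, one_ne_zero, not_false_eq_true, Matrix.one_apply_ne,
    sub_zero, map_add, map_ofNat] at hdet hone' ⊢
  linear_combination hone' - hdet

theorem not_irreducible_of_meridians_eq (ρ : DoubleTwistKnotGroup k l →* SL(2, R))
    (h : ρ (knotMk k l DoubleTwist.a) = ρ (knotMk k l DoubleTwist.b)) :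
    ¬ IsAbsIrreducibleRep ρ := by
  obtain ⟨c, hc⟩ := Module.End.exists_eigenvalue
    (Matrix.toLin' (geometricMatrix (ρ (knotMk k l DoubleTwist.a))))
  obtain ⟨v, hv⟩ := hc.exists_hasEigenvector
  have hv' := hv.apply_eq_smul
  rw [Matrix.toLin'_apply] at hv'
  refine not_isAbsIrreducibleRep_of_closure ρ closure_meridians hv.2 ?_
  rintro g (rfl | rfl)
  · exact ⟨c, hv'⟩
  · exact ⟨c, by rw [← h, hv']⟩

/-- The relation reads `rileyPoly · (A - B) = 0` over a domain, and `A = B` would give a common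
eigenvector. -/
theorem rileyPoly_eq_zero_of_irreducible (ρ : DoubleTwistKnotGroup k l →* SL(2, R))
    (h : IsAbsIrreducibleRep ρ) {x y : R}
    (hx : (ρ (knotMk k l DoubleTwist.a) : Matrix (Fin 2) (Fin 2) R).trace = x)
    (hy : ((ρ (knotMk k l DoubleTwist.b) * (ρ (knotMk k l DoubleTwist.a))⁻¹ : SL(2, R)) :
      Matrix (Fin 2) (Fin 2) R).trace = y) :
    rileyPoly k l x y = 0 := by
  have h₁ := slW_zpow_mul_sub_mul k l hx ((trace_meridian_eq ρ).trans hx) hy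
  rw [knot_relation ρ, sub_self] at h₁
  rcases smul_eq_zero.mp h₁.symm with h₂ | h₂
  · exact h₂
  · exact absurd h (not_irreducible_of_meridians_eq ρ
      (Matrix.SpecialLinearGroup.coeMonoidHom_injective (sub_eq_zero.mp h₂)))

end Reducible

/-! ### Riley's normal form. -/

section RileyRepresentation

variable {K : Type} [Field K]

/-- Riley's normal form for the meridian `a`. -/
def rileyA (s : K) (hs : s ≠ 0) : SL(2, K) :=
  ⟨!![s, 1; 0, s⁻¹], by simp [Matrix.det_fin_two, hs]⟩

/-- Riley's normal form for the meridian `b`. -/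
def rileyB (s y : K) (hs : s ≠ 0) : SL(2, K) :=
  ⟨!![s, 0; 2 - y, s⁻¹], by simp [Matrix.det_fin_two, hs]⟩

theorem trace_rileyA (s : K) (hs : s ≠ 0) :
    (rileyA s hs : Matrix (Fin 2) (Fin 2) K).trace = s + s⁻¹ := by
  simp [rileyA, Matrix.trace_fin_two]

theorem trace_rileyB (s y : K) (hs : s ≠ 0) :
    (rileyB s y hs : Matrix (Fin 2) (Fin 2) K).trace = s + s⁻¹ := by
  simp [rileyB, Matrix.trace_fin_two]

theorem trace_rileyB_mul_inv (s y : K) (hs : s ≠ 0) :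
    ((rileyB s y hs * (rileyA s hs)⁻¹ : SL(2, K)) : Matrix (Fin 2) (Fin 2) K).trace = y := by
  rw [Matrix.SpecialLinearGroup.coe_mul, Matrix.SpecialLinearGroup.coe_inv]
  simp [rileyA, rileyB, Matrix.trace_fin_two, Matrix.adjugate_fin_two, hs]
  ring

variable {k l : ℤ}

theorem irreducible_of_riley (ρ : DoubleTwistKnotGroup k l →* SL(2, K)) {s y : K} (hs : s ≠ 0)
    (hA : ρ (knotMk k l DoubleTwist.a) = rileyA s hs)
    (hB : ρ (knotMk k l DoubleTwist.b) = rileyB s y hs)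
    (hy : y ≠ 2) (hxy : y + 2 - (s + s⁻¹) ^ 2 ≠ 0) : IsAbsIrreducibleRep ρ := by
  by_contra hirr
  obtain ⟨v, hv0, hv⟩ := (not_isAbsIrreducibleRep_iff ρ).mp hirr
  obtain ⟨α, hα⟩ := hv (knotMk k l DoubleTwist.a)
  obtain ⟨β, hβ⟩ := hv (knotMk k l DoubleTwist.b)
  rw [hA] at hα
  rw [hB] at hβ
  set ι := algebraMap K (AlgebraicClosure (FractionRing K)) with hι
  have hinj : Function.Injective ι := algebraMap_geometric_injective
  have a₀ := congrFun hα 0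
  have a₁ := congrFun hα 1
  have b₀ := congrFun hβ 0
  have b₁ := congrFun hβ 1
  simp only [geometricMatrix, rileyA, rileyB, Matrix.mulVec, dotProduct, Fin.sum_univ_two,
    Matrix.map_apply, Matrix.of_apply, Matrix.cons_val_zero, Matrix.cons_val_one,
    Matrix.cons_val', Matrix.cons_val_fin_one, Pi.smul_apply, smul_eq_mul, map_one, map_zero,
    ← hι, zero_mul, one_mul, zero_add, add_zero] at a₀ a₁ b₀ b₁
  have hs' : ι s * ι s⁻¹ = 1 := by rw [← map_mul, mul_inv_cancel₀ hs, map_one]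
  have hy' : ι (2 - y) ≠ 0 := by
    rw [map_ne_zero_iff _ hinj]
    exact sub_ne_zero.mpr hy.symm
  -- Eliminating the eigenvalues leaves two eigenlines for each matrix. They can coincide only if `y
  -- = 2` or `y + 2 = (s + s⁻¹)²`.
  have e₁ : v 1 * (v 1 - (ι s⁻¹ - ι s) * v 0) = 0 := by
    linear_combination v 1 * a₀ - v 0 * a₁
  have e₂ : v 0 * (ι (2 - y) * v 0 + (ι s⁻¹ - ι s) * v 1) = 0 := by
    linear_combination v 0 * b₁ - v 1 * b₀
  have hv00 : v 0 ≠ 0 := by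
    intro h0
    rw [h0, mul_zero, sub_zero] at e₁
    apply hv0
    ext i
    fin_cases i
    · exact h0
    · exact mul_self_eq_zero.mp e₁
  have e₃ := (mul_eq_zero.mp e₂).resolve_left hv00
  rcases mul_eq_zero.mp e₁ with h₁ | h₁
  · rw [h₁, mul_zero, add_zero] at e₃
    exact (mul_ne_zero hy' hv00) e₃
  · have h₂ : v 0 * ι (y + 2 - (s + s⁻¹) ^ 2) = 0 := by
      simp only [map_sub, map_add, map_pow, map_ofNat] at e₃ ⊢
      linear_combination (-1 : AlgebraicClosure (FractionRing K)) * e₃ +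
        (ι s⁻¹ - ι s) * h₁ - 4 * v 0 * hs'
    exact hxy ((map_eq_zero_iff _ hinj).mp ((mul_eq_zero.mp h₂).resolve_left hv00))

theorem not_irreducible_of_riley (ρ : DoubleTwistKnotGroup k l →* SL(2, K)) {s : K} (hs : s ≠ 0)
    (hA : ρ (knotMk k l DoubleTwist.a) = rileyA s hs)
    (hB : ρ (knotMk k l DoubleTwist.b) = rileyB s 2 hs) : ¬ IsAbsIrreducibleRep ρ := by
  refine not_isAbsIrreducibleRep_of_closure ρ closure_meridians (v := ![1, 0]) ?_ ?_
  · intro h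
    exact one_ne_zero (congrFun h 0)
  · rintro g (rfl | rfl)
    · refine ⟨algebraMap _ _ s, ?_⟩
      rw [hA]
      ext i
      fin_cases i <;> simp [geometricMatrix, rileyA, Matrix.mulVec, dotProduct]
    · refine ⟨algebraMap _ _ s, ?_⟩
      rw [hB]
      ext i
      fin_cases i <;> simp [geometricMatrix, rileyB, Matrix.mulVec, dotProduct]

end RileyRepresentation

/-! ### Liminal characters and roots of the Alexander polynomial. -/

section Liminal

variable {p : ℕ} [Fact p.Prime] {k l : ℤ}

theorem Continuous.rileyPoly {Y : Type*} [TopologicalSpace Y] (k l : ℤ) {f g : Y → ℤ_[p]}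
    (hf : Continuous f) (hg : Continuous g) : Continuous fun t => rileyPoly k l (f t) (g t) := by
  have hS (n : ℤ) {f : Y → ℤ_[p]} (hf : Continuous f) :
      Continuous fun t => (Chebyshev.S ℤ_[p] n).eval (f t) :=
    (Chebyshev.S ℤ_[p] n).continuous.comp hf
  have hS₁ := hS (k - 1) hg
  have hS₂ := hS (k - 2) hg
  have hz : Continuous fun t => wTrace k (f t) (g t) := by
    unfold wTrace
    fun_prop
  have hS₃ := hS (l - 1) hz
  have hS₄ := hS (l - 2) hz
  unfold _root_.rileyPoly
  fun_prop

theorem IsReducibleCharacter.apply_eq_two {χ : DoubleTwistKnotGroup k l → ℤ_[p]}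
    (hχ : IsReducibleCharacter χ) :
    χ (knotMk k l DoubleTwist.b * (knotMk k l DoubleTwist.a)⁻¹) = 2 := by
  obtain ⟨R, _, _, _, ρ, hinj, htr, hred⟩ := hχ
  apply hinj
  rw [htr, map_mul, map_inv, trace_eq_two_of_not_irreducible ρ hred, map_ofNat]

theorem IsIrreducibleCharacter.rileyPoly_eq_zero {χ : DoubleTwistKnotGroup k l → ℤ_[p]}
    (hχ : IsIrreducibleCharacter χ) :
    rileyPoly k l (χ (knotMk k l DoubleTwist.a))
      (χ (knotMk k l DoubleTwist.b * (knotMk k l DoubleTwist.a)⁻¹)) = 0 := by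
  obtain ⟨R, _, _, _, ρ, hinj, htr, hirr⟩ := hχ
  apply hinj
  rw [map_rileyPoly, map_zero, htr, htr, map_mul, map_inv]
  exact rileyPoly_eq_zero_of_irreducible ρ hirr rfl rfl

/-- The zero set of the Riley polynomial is closed and contains every irreducible character, hence
also their limits. -/
theorem IsLiminalCharacter.rileyPoly_eq_zero {χ : DoubleTwistKnotGroup k l → ℤ_[p]}
    (hχ : IsLiminalCharacter χ) :
    rileyPoly k l (χ (knotMk k l DoubleTwist.a))
      (χ (knotMk k l DoubleTwist.b * (knotMk k l DoubleTwist.a)⁻¹)) = 0 := by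
  by_contra hne
  have hcont : Continuous fun χ' : DoubleTwistKnotGroup k l → ℤ_[p] =>
      rileyPoly k l (χ' (knotMk k l DoubleTwist.a))
        (χ' (knotMk k l DoubleTwist.b * (knotMk k l DoubleTwist.a)⁻¹)) :=
    (continuous_apply _).rileyPoly k l (continuous_apply _)
  obtain ⟨χ', hχ', hirr⟩ := hχ.2 _ (isOpen_ne.preimage hcont) hne
  exact hχ' hirr.rileyPoly_eq_zero

theorem exists_root_of_isLiminalCharacter {χ : DoubleTwistKnotGroup k l → ℤ_[p]}
    (hχ : IsLiminalCharacter χ) : ∃ x : ℤ_[p], 1 + ((k * l : ℤ) : ℤ_[p]) * (x ^ 2 - 4) = 0 := by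
  have h := hχ.rileyPoly_eq_zero
  rw [hχ.1.apply_eq_two, rileyPoly_two, ← Int.cast_mul] at h
  exact ⟨_, h⟩

theorem exists_riley_root_near {x : ℤ_[p]} (hkl : k * l ≠ 0)
    (hx : 1 + ((k * l : ℤ) : ℤ_[p]) * (x ^ 2 - 4) = 0) {ε : ℝ} (hε : 0 < ε) :
    ∀ᶠ y in 𝓝 (2 : ℤ_[p]), ∃ z, rileyPoly k l z y = 0 ∧ ‖z - x‖ < ε := by
  -- The outer variable is the trace `x` to be solved for; the inner one is the parameter `y`.
  let Φ : ℤ_[p][X][X] := rileyPoly k l X (C X)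
  have hΦ (y : ℤ_[p]) : Φ.map (evalRingHom y) = rileyPoly k l X (C y) := by
    have := map_rileyPoly (mapRingHom (evalRingHom y)) k l (X : ℤ_[p][X][X]) (C X)
    simpa [Φ] using this
  have hev (y z : ℤ_[p]) : (rileyPoly k l X (C y)).eval z = rileyPoly k l z y := by
    have := map_rileyPoly (evalRingHom z) k l (X : ℤ_[p][X]) (C y)
    simpa using this
  have h2 : rileyPoly k l (X : ℤ_[p][X]) (C 2) =
      1 + C ((k * l : ℤ) : ℤ_[p]) * (X ^ 2 - C 4) := by
    rw [map_ofNat, rileyPoly_two]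
    simp [map_ofNat]
  have hkl' : ((k * l : ℤ) : ℤ_[p]) ≠ 0 := Int.cast_ne_zero.mpr hkl
  -- The derivative at `x` is `2klx`; it is nonzero, since `x = 0` would give `4kl = 1`.
  have hx0 : x ≠ 0 := by
    rintro rfl
    have : (1 - 4 * (k * l) : ℤ) = 0 := by
      have h : ((1 - 4 * (k * l) : ℤ) : ℤ_[p]) = 0 := by
        push_cast at hx ⊢
        linear_combination hx
      exact_mod_cast h
    omega
  have h := exists_root_near Φ (x := x) (y₀ := 2) ?_ ?_ hε
  · simpa only [hΦ, hev] using h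
  · rw [hΦ, h2]
    simpa using hx
  · rw [hΦ, h2]
    have h2' : (2 : ℤ_[p]) ≠ 0 := two_ne_zero
    simp only [derivative_add, derivative_one, derivative_mul, derivative_C, zero_mul, zero_add,
      derivative_sub, derivative_X_pow, sub_zero, eval_mul, eval_C, eval_pow, eval_X]
    simpa using ⟨Int.cast_ne_zero.mp hkl' |> mul_ne_zero_iff.mp, hx0⟩

/-- Over the algebraic closure `s + s⁻¹ = x` is solvable, so every zero of the Riley polynomial is
realised by Riley's matrices. -/
theorem exists_riley_rep {x y : ℤ_[p]} (h : rileyPoly k l x y = 0) :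
    ∃ (s : AlgebraicClosure ℚ_[p]) (hs : s ≠ 0)
      (ρ : DoubleTwistKnotGroup k l →* SL(2, AlgebraicClosure ℚ_[p])),
      s + s⁻¹ = algebraMap ℤ_[p] (AlgebraicClosure ℚ_[p]) x ∧
      ρ (knotMk k l DoubleTwist.a) = rileyA s hs ∧
      ρ (knotMk k l DoubleTwist.b) =
        rileyB s (algebraMap ℤ_[p] (AlgebraicClosure ℚ_[p]) y) hs := by
  set K := AlgebraicClosure ℚ_[p]
  set x' := algebraMap ℤ_[p] K x with hx'
  set y' := algebraMap ℤ_[p] K y with hy'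
  obtain ⟨s, hs⟩ := IsAlgClosed.exists_root (X ^ 2 - C x' * X + 1 : K[X]) (by
    have : (X ^ 2 - C x' * X + 1 : K[X]).degree = 2 := by compute_degree!
    rw [this]; exact two_ne_zero)
  have hs' : s ^ 2 - x' * s + 1 = 0 := by simpa using hs
  have hs0 : s ≠ 0 := by
    rintro rfl
    simp at hs'
  have hsum : s + s⁻¹ = x' := by
    linear_combination s⁻¹ * hs' - (s - x') * mul_inv_cancel₀ hs0
  obtain ⟨ρ, hA, hB⟩ := exists_knot_rep (k := k) (l := l)
    ((trace_rileyA s hs0).trans hsum) ((trace_rileyB s y' hs0).trans hsum)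
    (trace_rileyB_mul_inv s y' hs0) (by rw [hx', hy', ← map_rileyPoly, h, map_zero])
  exact ⟨s, hs0, ρ, hsum, hA, hB⟩

theorem algebraMap_padicInt_algebraicClosure_injective :
    Function.Injective (algebraMap ℤ_[p] (AlgebraicClosure ℚ_[p])) := by
  rw [IsScalarTower.algebraMap_eq ℤ_[p] ℚ_[p] (AlgebraicClosure ℚ_[p])]
  exact (algebraMap ℚ_[p] _).injective.comp (IsFractionRing.injective ℤ_[p] ℚ_[p])

theorem exists_isLiminalCharacter (hkl : k * l ≠ 0) {x : ℤ_[p]}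
    (hx : 1 + ((k * l : ℤ) : ℤ_[p]) * (x ^ 2 - 4) = 0) :
    ∃ χ : DoubleTwistKnotGroup k l → ℤ_[p], IsLiminalCharacter χ := by
  choose P hPc hP using exists_word_trace ℤ_[p]
  -- `T` is defined at every pair through a chosen word for each group element; at zeros of the
  -- Riley polynomial it is a genuine character.
  let T : ℤ_[p] × ℤ_[p] → DoubleTwistKnotGroup k l → ℤ_[p] :=
    fun q g => P (Function.surjInv knotMk_surjective g) q
  have hT : Continuous T := continuous_pi fun g => hPc _
  have htrace {z y : ℤ_[p]} {s : AlgebraicClosure ℚ_[p]} {hs : s ≠ 0}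
      {ρ : DoubleTwistKnotGroup k l →* SL(2, AlgebraicClosure ℚ_[p])}
      (hsum : s + s⁻¹ = algebraMap ℤ_[p] (AlgebraicClosure ℚ_[p]) z)
      (hA : ρ (knotMk k l DoubleTwist.a) = rileyA s hs)
      (hB : ρ (knotMk k l DoubleTwist.b) =
        rileyB s (algebraMap ℤ_[p] (AlgebraicClosure ℚ_[p]) y) hs) : IsTraceOf (T (z, y)) ρ := by
    intro g
    have h := hP (Function.surjInv knotMk_surjective g) _ _ _ (ρ.comp (knotMk k l)) z y
      (by rw [MonoidHom.comp_apply, hA, trace_rileyA, hsum])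
      (by rw [MonoidHom.comp_apply, hB, trace_rileyB, hsum])
      (by rw [MonoidHom.comp_apply, MonoidHom.comp_apply, hA, hB, trace_rileyB_mul_inv])
    rw [MonoidHom.comp_apply, Function.surjInv_eq knotMk_surjective g] at h
    exact h.symm
  have hinj := algebraMap_padicInt_algebraicClosure_injective (p := p)
  refine ⟨T (x, 2), ?_, fun U hU hxU => ?_⟩
  · obtain ⟨s, hs, ρ, hsum, hA, hB⟩ := exists_riley_rep (k := k) (l := l) (x := x) (y := 2)
      (by rw [rileyPoly_two]; exact_mod_cast hx)
    refine ⟨_, _, inferInstance, _, ρ, hinj, htrace hsum hA hB, ?_⟩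
    rw [map_ofNat] at hB
    exact not_irreducible_of_riley ρ hs hA hB
  -- If `x² = 4`, the equation for `x` would read `1 = 0`. The inequality is open, so it persists at
  -- nearby `(z, y)`.
  · have hne : (2 : ℤ_[p]) + 2 - x ^ 2 ≠ 0 := by
      intro h0
      have : x ^ 2 - 4 = 0 := by linear_combination -h0
      simp [this] at hx
    have hV : (T ⁻¹' U) ∩ {q | q.2 + 2 - q.1 ^ 2 ≠ 0} ∈ 𝓝 (x, (2 : ℤ_[p])) :=
      ((hU.preimage hT).inter (isOpen_ne.preimage (by fun_prop))).mem_nhds ⟨hxU, hne⟩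
    obtain ⟨ε, hε, hball⟩ := Metric.mem_nhds_iff.mp hV
    -- The values `y = 2 + pⁿ` approach `2` without reaching it, as irreducibility requires.
    have hlim : Tendsto (fun n : ℕ => (2 : ℤ_[p]) + (p : ℤ_[p]) ^ n) atTop (𝓝 2) := by
      simpa using (tendsto_pow_atTop_nhds_zero_of_norm_lt_one
        (PadicInt.norm_lt_one_iff_dvd (p : ℤ_[p]) |>.mpr dvd_rfl)).const_add (2 : ℤ_[p])
    obtain ⟨n, ⟨z, hz, hzx⟩, hy⟩ := (hlim.eventually
      ((exists_riley_root_near hkl hx hε).and (Metric.ball_mem_nhds _ hε))).exists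
    set y : ℤ_[p] := 2 + (p : ℤ_[p]) ^ n with hydef
    have hy2 : y ≠ 2 := by
      have hp : (p : ℤ_[p]) ^ n ≠ 0 :=
        pow_ne_zero n (Nat.cast_ne_zero.mpr (Fact.out : p.Prime).ne_zero)
      simpa only [hydef, ne_eq, add_eq_left] using hp
    have hmem : (z, y) ∈ Metric.ball (x, (2 : ℤ_[p])) ε := by
      rw [← ball_prod_same]
      exact ⟨by rwa [Metric.mem_ball, dist_eq_norm], hy⟩
    obtain ⟨hzU, hzy⟩ := hball hmem
    obtain ⟨s, hs, ρ, hsum, hA, hB⟩ := exists_riley_rep hz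
    refine ⟨T (z, y), hzU, _, _, inferInstance, _, ρ, hinj, htrace hsum hA hB,
      irreducible_of_riley ρ hs hA hB ?_ ?_⟩
    · rw [← map_ofNat (algebraMap ℤ_[p] (AlgebraicClosure ℚ_[p])) 2]
      exact fun h => hy2 (hinj h)
    · rw [hsum]
      intro h0
      refine hzy (hinj ?_)
      simpa [map_ofNat] using h0

end Liminal

theorem theorem3p1 (p : ℕ) [Fact p.Prime] (k l : ℤ) (hkl : k * l ≠ 0) :
    (∃ χ : DoubleTwistKnotGroup k l → ℤ_[p], IsLiminalCharacter χ) ↔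
      ((p = 2 ∧ 4 * k ^ 2 * l ^ 2 - k * l ≡ 1 [ZMOD 8]) ∨
        (p ≠ 2 ∧ ¬ (p : ℤ) ∣ k * l ∧
          legendreSym p (squareFreePart (4 * k ^ 2 * l ^ 2 - k * l)) = 1)) := by
  have hD : 4 * k ^ 2 * l ^ 2 - k * l = 4 * (k * l) ^ 2 - k * l := by ring
  rw [hD, ← exists_padicInt_root_iff hkl]
  constructor
  · rintro ⟨χ, hχ⟩
    exact exists_root_of_isLiminalCharacter hχ
  · rintro ⟨x, hx⟩
    exact exists_isLiminalCharacter hkl hx
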